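/- Let $p$ be a prime and let $G$ be a group of order $p^7$ whose nilpotency class is at least $3$ and whose center $Z(G)$ is not contained in the commutator subgroup $G'$. Let $\mathrm{Aut}_c(G)$ denote the group of central automorphisms of $G$, that is, the automorphisms of $G$ that commute with all inner automorphisms, and let $\mathrm{Aut}_c^Z(G)$ denote the subgroup of those central automorphisms that fix $Z(G)$ element-wise. Then $$Z(\mathrm{Inn}(G)) = \mathrm{Aut}_c^Z(G) < \mathrm{Aut}_c(G)$$ (equality of subgroups of $\mathrm{Aut}(G)$, and proper containment) holds if and only if $Z(G)$ is cyclic of order $p^2$, $|G'| = p^4$, and $G$ has nilpotency class $4$. -/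

import Mathlib

/-- The group of inner automorphisms of `G`. -/
def innerAut (G : Type*) [Group G] : Subgroup (MulAut G) :=
  (MulAut.conj : G →* MulAut G).range

/-- The center of the group of inner automorphisms, viewed as a subgroup of the full
automorphism group. -/
def centerInnerAut (G : Type*) [Group G] : Subgroup (MulAut G) :=
  (Subgroup.center (innerAut G)).map (innerAut G).subtype

/-- The group of central automorphisms of `G`: the automorphisms that commute with all inner
automorphisms. -/
def centralAut (G : Type*) [Group G] : Subgroup (MulAut G) :=
  Subgroup.centralizer (innerAut G : Set (MulAut G))

/-- The group of central automorphisms of `G` that fix the center of `G` element-wise. -/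
def centralAutFixingCenter (G : Type*) [Group G] : Subgroup (MulAut G) :=
  centralAut G ⊓ fixingSubgroup (MulAut G) (Subgroup.center G : Set G)

/-- Central automorphisms are those with `x⁻¹ * α x` in the center for all `x`. -/
theorem mem_centralAut_iff {G : Type*} [Group G] (α : MulAut G) :
    α ∈ centralAut G ↔ ∀ x : G, x⁻¹ * α x ∈ Subgroup.center G := by
  have key : ∀ x : G, MulAut.conj x * α = α * MulAut.conj x ↔
      x⁻¹ * α x ∈ Subgroup.center G := by
    intro x
    rw [Subgroup.mem_center_iff, MulEquiv.ext_iff, ← α.forall_congr_right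
      (q := fun g => g * (x⁻¹ * α x) = x⁻¹ * α x * g)]
    refine forall_congr' fun g => ?_
    simp only [MulAut.mul_apply, MulAut.conj_apply, map_mul, map_inv]
    constructor
    · intro h
      have h2 := congrArg (fun t => x⁻¹ * t * α x) h
      simpa [mul_assoc] using h2
    · intro h
      have h2 := congrArg (fun t => x * t * (α x)⁻¹) h
      simpa [mul_assoc] using h2
  simp only [centralAut, innerAut, Subgroup.mem_centralizer_iff, SetLike.mem_coe,
    MonoidHom.mem_range, forall_exists_index, forall_apply_eq_imp_iff, key]

theorem mem_centralAutFixingCenter_iff {G : Type*} [Group G] (α : MulAut G) :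
    α ∈ centralAutFixingCenter G ↔
      (∀ x : G, x⁻¹ * α x ∈ Subgroup.center G) ∧ ∀ z ∈ Subgroup.center G, α z = z := by
  simp [centralAutFixingCenter, Subgroup.mem_inf, mem_centralAut_iff, mem_fixingSubgroup_iff]

/-! Write Z for Z(G) and H for G/Z. A central automorphism α fixing Z element-wise amounts to the
homomorphism x ↦ x⁻¹α(x) from H to Z, and every such homomorphism occurs
(`centralAutFixingCenterEquiv`). Since Z(Inn G) ≅ Z(H) always lies in this group of automorphisms,
the equality is the numerical condition |Z(H)| = |Hom(Hᵃᵇ, Z)| (`centerInnerAut_eq_iff_card`).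

Suppose it holds. G' ∩ Z is nontrivial and proper in Z, so |Z| ≥ p². H is a nonabelian p-group, so
Hᵃᵇ is not cyclic and Z(H) has index at least p² in H. There are at least p² homomorphisms Hᵃᵇ → Z,
and at least p⁴ if Z is not cyclic; counting orders then makes Z cyclic and leaves (|Z|, |Z(H)|) =
(p³, p²), (p², p³) or (p², p²). In the first two cases Z(H) has index p², so |H'| = p and there are
too many homomorphisms once the exponent of Hᵃᵇ is known to divide |Z|. For (p², p³) this needs more
than counting: `exponent_dvd_of_centerInnerAut_eq` uses that each homomorphism comes from a
conjugation. In the last case |Hᵃᵇ| = p², which gives |G'| and the class.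

Conversely, H has order p⁵, class 3 and |Hᵃᵇ| = p², which forces |Z(H)| = p². Strictness comes from
x ↦ x·f(x), where f : Gᵃᵇ → Z does not kill a chosen central element outside G'. -/

open scoped commutatorElement

/-! ### Cyclic abelianizations and centers of index p². -/

/-- Induction along central quotients: once G/Z(G) is abelian, G' ≤ Z(G), so G/Z(G) is a quotient of
the cyclic group Gᵃᵇ; a cyclic central quotient makes G abelian. -/
theorem isMulCommutative_of_isCyclic_abelianization (G : Type*) [Group G] [Group.IsNilpotent G] :
    IsCyclic (Abelianization G) → IsMulCommutative G := by
  refine Group.nilpotent_center_quotient_ind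
    (P := fun G _ _ => IsCyclic (Abelianization G) → IsMulCommutative G) G ?_ ?_
  · exact fun G _ _ _ => ⟨⟨fun _ _ => Subsingleton.elim _ _⟩⟩
  · intro G _ _ ih h
    have hs : Function.Surjective (Abelianization.map (QuotientGroup.mk' (Subgroup.center G))) := by
      intro y
      obtain ⟨y, rfl⟩ := QuotientGroup.mk_surjective y
      obtain ⟨x, rfl⟩ := QuotientGroup.mk_surjective y
      exact ⟨Abelianization.of x, rfl⟩
    have hc := ih (isCyclic_of_surjective _ hs)
    have : Subgroup.center G ≥ commutator G :=
      Subgroup.Normal.quotient_commutative_iff_commutator_le.mp hc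
    have hs2 : Function.Surjective (QuotientGroup.map (commutator G) (Subgroup.center G)
        (MonoidHom.id G) this) := by
      intro y
      obtain ⟨y, rfl⟩ := QuotientGroup.mk_surjective y
      exact ⟨QuotientGroup.mk y, rfl⟩
    have h' : IsCyclic (G ⧸ commutator G) := h
    have := isCyclic_of_surjective _ hs2
    exact isMulCommutative_of_isCyclic_quotient_center_self G

theorem IsPGroup.sq_dvd_card_of_not_isCyclic {p : ℕ} [Fact p.Prime] {G : Type*} [Group G] [Finite G]
    (hG : IsPGroup p G) (h : ¬ IsCyclic G) : p ^ 2 ∣ Nat.card G := by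
  obtain ⟨n, hn⟩ := IsPGroup.iff_card.mp hG
  rw [hn]
  apply pow_dvd_pow
  by_contra! hlt
  interval_cases n
  · have := (Nat.card_eq_one_iff_unique.mp (by simpa using hn)).1
    exact h inferInstance
  · exact h (isCyclic_of_prime_card (by simpa using hn))

theorem IsPGroup.sq_dvd_index_center {p : ℕ} [Fact p.Prime] {G : Type*} [Group G] [Finite G]
    (hG : IsPGroup p G) (h : ¬ IsMulCommutative G) : p ^ 2 ∣ (Subgroup.center G).index :=
  (hG.to_quotient _).sq_dvd_card_of_not_isCyclic
    fun _ => h (isMulCommutative_of_isCyclic_quotient_center_self G)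

theorem IsPGroup.not_isCyclic_abelianization {p : ℕ} [Fact p.Prime] {G : Type*} [Group G] [Finite G]
    (hG : IsPGroup p G) (h : ¬ IsMulCommutative G) : ¬ IsCyclic (Abelianization G) := by
  have := hG.isNilpotent
  exact mt (isMulCommutative_of_isCyclic_abelianization G) h

theorem pow_mem_center_of_index_eq_sq {p : ℕ} [Fact p.Prime] {G : Type*} [Group G]
    (h : (Subgroup.center G).index = p ^ 2) (a : G) : a ^ p ∈ Subgroup.center G := by
  have hnc : ¬ IsCyclic (G ⧸ Subgroup.center G) := fun _ => by
    have := isMulCommutative_of_isCyclic_quotient_center_self G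
    rw [Subgroup.center_eq_top, Subgroup.index_top] at h
    exact absurd h.symm (Nat.one_lt_pow two_ne_zero (Fact.out : p.Prime).one_lt).ne'
  have he := (not_isCyclic_iff_exponent_eq_prime (Fact.out : p.Prime) h).mp hnc
  rw [← QuotientGroup.eq_one_iff, QuotientGroup.mk_pow, ← he, Monoid.pow_exponent_eq_one]

/-- For noncommuting a and b, the index leaves room for only two steps above Z(G), so a, b and Z(G)
generate G and G' = ⟨[a, b]⟩. As commutators are central, x ↦ [x, b] is a homomorphism; since a ^ p
is central, [a, b] has order p. -/
theorem card_commutator_of_index_center_eq_sq {p : ℕ} [hp : Fact p.Prime] {G : Type*} [Group G]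
    (h : (Subgroup.center G).index = p ^ 2) : Nat.card (commutator G) = p := by
  have hpp := hp.out
  have hab : ∃ a b : G, a * b ≠ b * a := by
    by_contra! hc
    have : IsMulCommutative G := ⟨⟨hc⟩⟩
    rw [Subgroup.center_eq_top, Subgroup.index_top] at h
    exact absurd h.symm (Nat.one_lt_pow two_ne_zero hpp.one_lt).ne'
  obtain ⟨a, b, hab⟩ := hab
  have hQ := IsPGroup.isMulCommutative_of_card_eq_prime_sq (G := G ⧸ Subgroup.center G) h
  have hle : commutator G ≤ Subgroup.center G :=
    Subgroup.Normal.quotient_commutative_iff_commutator_le.mp hQ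
  have hcz : ∀ x y : G, ⁅x, y⁆ ∈ Subgroup.center G := fun x y =>
    hle (Subgroup.commutator_mem_commutator (Subgroup.mem_top _) (Subgroup.mem_top _))
  set c := ⁅a, b⁆ with hc
  have hc1 : c ≠ 1 := fun h => hab (commutatorElement_eq_one_iff_mul_comm.mp h)
  have hmul : ∀ x y : G, ⁅x * y, b⁆ = ⁅x, b⁆ * ⁅y, b⁆ := by
    intro x y
    rw [commutatorElement_mul_left_eq_conj_mul, Subgroup.mem_center_iff.mp (hcz y b) x, mul_inv_cancel_right,
      ← Subgroup.mem_center_iff.mp (hcz y b)]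
  let φ : G →* G := MonoidHom.mk' (fun x => ⁅x, b⁆) hmul
  have hcp : c ^ p = 1 := by
    have : φ (a ^ p) = 1 := commutatorElement_eq_one_iff_mul_comm.mpr
      ((Subgroup.mem_center_iff.mp (pow_mem_center_of_index_eq_sq h a) b).symm)
    rwa [map_pow] at this
  have hoc : orderOf c = p := orderOf_eq_prime hcp hc1
  set M := Subgroup.closure ({a} ∪ (Subgroup.center G : Set G)) with hM
  set S := Subgroup.closure ({a, b} ∪ (Subgroup.center G : Set G)) with hS
  have hZM : Subgroup.center G ≤ M := fun z hz => Subgroup.subset_closure (Or.inr hz)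
  have hMS : M ≤ S := Subgroup.closure_mono (by
    apply Set.union_subset_union_left; simp)
  have haM : a ∈ M := Subgroup.subset_closure (Or.inl rfl)
  have hbS : b ∈ S := Subgroup.subset_closure (Or.inl (by simp))
  have haZ : a ∉ Subgroup.center G := fun h => hab (Subgroup.mem_center_iff.mp h b).symm
  have hbM : b ∉ M := by
    intro hb
    have : M ≤ Subgroup.centralizer {a} := by
      rw [hM, Subgroup.closure_le]
      rintro x (rfl | hx)
      · exact Subgroup.mem_centralizer_singleton_iff.mpr rfl
      · exact Subgroup.mem_centralizer_singleton_iff.mpr (Subgroup.mem_center_iff.mp hx a).symm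
    exact hab (Subgroup.mem_centralizer_singleton_iff.mp (this hb)).symm
  -- In Z(G) < M < S each step has index at least p, which uses up the whole index p².
  have hST : S = ⊤ := by
    rw [← Subgroup.index_eq_one]
    have h1 := Subgroup.relIndex_mul_index hZM
    have h2 := Subgroup.relIndex_mul_index hMS
    rw [h] at h1
    have n1 : (Subgroup.center G).relIndex M ≠ 1 := fun h =>
      haZ (Subgroup.relIndex_eq_one.mp h haM)
    have n2 : M.relIndex S ≠ 1 := fun h => hbM (Subgroup.relIndex_eq_one.mp h hbS)
    obtain ⟨i, hi, hi'⟩ := (Nat.dvd_prime_pow hpp).mp (Dvd.intro _ h1)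
    obtain ⟨j, hj, hj'⟩ := (Nat.dvd_prime_pow hpp).mp
      ((Dvd.intro _ h2).trans (Dvd.intro_left _ h1))
    rw [hi', ← h2, hj', ← mul_assoc, ← pow_add] at h1
    rw [hi'] at n1
    rw [hj'] at n2
    have hi0 : i ≠ 0 := by rintro rfl; simp at n1
    have hj0 : j ≠ 0 := by rintro rfl; simp at n2
    have : p ^ 2 * S.index ≤ p ^ 2 * 1 := by
      rw [mul_one]
      conv_rhs => rw [← h1]
      exact Nat.mul_le_mul_right _ (Nat.pow_le_pow_right hpp.pos (by omega))
    have h3 := Nat.le_of_mul_le_mul_left this (pow_pos hpp.pos 2)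
    have h4 : S.index ≠ 0 := by
      intro h0; rw [h0, mul_zero] at h1
      exact (pow_pos hpp.pos 2).ne h1
    omega
  have hcc : commutator G = Subgroup.zpowers c := by
    apply le_antisymm
    · have hN : (Subgroup.zpowers c).Normal := by
        refine ⟨fun n hn g => ?_⟩
        have : n ∈ Subgroup.center G := (Subgroup.zpowers_le.mpr (hcz a b)) hn
        rwa [Subgroup.mem_center_iff.mp this g, mul_inv_cancel_right]
      let π := QuotientGroup.mk' (Subgroup.zpowers c)
      have key : ∀ x y, x ∈ ({a, b} ∪ (Subgroup.center G : Set G)) →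
          y ∈ ({a, b} ∪ (Subgroup.center G : Set G)) → π x * π y = π y * π x := by
        have hπ : π a * π b = π b * π a := by
          rw [← commutatorElement_eq_one_iff_mul_comm, ← map_commutatorElement]
          exact (QuotientGroup.eq_one_iff _).mpr (Subgroup.mem_zpowers c)
        rintro x y ((rfl | rfl) | hx) ((rfl | rfl) | hy)
        all_goals first | rfl | exact hπ | exact hπ.symm | skip
        all_goals rw [← map_mul, ← map_mul]
        · rw [Subgroup.mem_center_iff.mp hy]
        · rw [Subgroup.mem_center_iff.mp hy]
        · rw [Subgroup.mem_center_iff.mp hx]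
        · rw [Subgroup.mem_center_iff.mp hx]
        · rw [Subgroup.mem_center_iff.mp hx]
      have key2 : ∀ x ∈ ({a, b} ∪ (Subgroup.center G : Set G)), ∀ y : G,
          π x * π y = π y * π x := by
        intro x hx
        have : S ≤ (Subgroup.centralizer {π x}).comap π := by
          rw [hS, Subgroup.closure_le]
          intro y hy
          exact Subgroup.mem_centralizer_singleton_iff.mpr (key y x hy hx)
        intro y
        have hy := this (hST ▸ Subgroup.mem_top y)
        exact (Subgroup.mem_centralizer_singleton_iff.mp (Subgroup.mem_comap.mp hy)).symm
      have key3 : ∀ x y : G, π x * π y = π y * π x := by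
        intro x y
        have : S ≤ (Subgroup.centralizer {π y}).comap π := by
          rw [hS, Subgroup.closure_le]
          intro x hx
          exact Subgroup.mem_centralizer_singleton_iff.mpr (key2 x hx y)
        exact Subgroup.mem_centralizer_singleton_iff.mp
          (Subgroup.mem_comap.mp (this (hST ▸ Subgroup.mem_top x)))
      rw [commutator_def, Subgroup.commutator_le]
      intro x _ y _
      rw [← QuotientGroup.eq_one_iff]
      change π _ = 1
      rw [map_commutatorElement, commutatorElement_eq_one_iff_mul_comm]
      exact key3 x y
    · exact Subgroup.zpowers_le.mpr
        (Subgroup.commutator_mem_commutator (Subgroup.mem_top _) (Subgroup.mem_top _))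
  rw [hcc, Nat.card_zpowers, hoc]

/-! ### Counting homomorphisms between finite abelian p-groups. -/

/-- A Frattini argument: if a generates A modulo p-th powers, then the p-th power map is onto on
A/⟨a⟩, hence injective, and a finite p-group with this property is trivial. -/
theorem IsPGroup.not_isCyclic_quotient_range_pow {p : ℕ} [Fact p.Prime] {A : Type*}
    [CommGroup A] [Finite A] (hA : IsPGroup p A) (h : ¬ IsCyclic A) :
    ¬ IsCyclic (A ⧸ (powMonoidHom p : A →* A).range) := by
  intro hc
  apply h
  obtain ⟨g, hg⟩ := hc.exists_generator
  obtain ⟨a, rfl⟩ := QuotientGroup.mk_surjective g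
  refine ⟨⟨a, ?_⟩⟩
  have hB : IsPGroup p (A ⧸ Subgroup.zpowers a) := hA.to_quotient _
  have hs : Function.Surjective (fun x : A ⧸ Subgroup.zpowers a => x ^ p) := by
    intro y
    obtain ⟨y, rfl⟩ := QuotientGroup.mk_surjective y
    obtain ⟨k, hk⟩ := Subgroup.mem_zpowers_iff.mp (hg y)
    rw [← QuotientGroup.mk_zpow, QuotientGroup.eq] at hk
    obtain ⟨x, hx⟩ := hk
    refine ⟨QuotientGroup.mk x, ?_⟩
    dsimp only
    rw [← QuotientGroup.mk_pow, QuotientGroup.eq]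
    change x ^ p = _ at hx
    rw [hx]
    refine Subgroup.mem_zpowers_iff.mpr ⟨k, ?_⟩
    simp [mul_comm]
  have hi := Finite.injective_iff_surjective.mpr hs
  intro x
  change x ∈ Subgroup.zpowers a
  rw [← QuotientGroup.eq_one_iff]
  obtain ⟨k, hk⟩ := hB (x : A ⧸ Subgroup.zpowers a)
  have : ∀ k, ∀ y : A ⧸ Subgroup.zpowers a, y ^ p ^ k = 1 → y = 1 := by
    intro k
    induction k with
    | zero => simp
    | succ k ih =>
      intro y hy
      rw [pow_succ, pow_mul] at hy
      exact ih y (hi (by simpa using hy))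
  exact this k _ hk

noncomputable def rootsOfUnityMulEquivOfIsCyclic (Z : Type*) [CommGroup Z] [Finite Z] [IsCyclic Z] :
    rootsOfUnity (Nat.card Z) ℂ ≃* Z :=
  haveI : NeZero (Nat.card Z) := ⟨Nat.card_pos.ne'⟩
  mulEquivOfCyclicCardEq (Complex.card_rootsOfUnity _)

theorem card_monoidHom_of_isCyclic (A Z : Type*) [CommGroup A] [Finite A] [CommGroup Z] [Finite Z]
    [IsCyclic Z] (h : Monoid.exponent A ∣ Nat.card Z) : Nat.card (A →* Z) = Nat.card A := by
  have : NeZero (Monoid.exponent A) := ⟨Monoid.exponent_ne_zero_of_finite⟩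
  rw [← CommGroup.card_monoidHom_of_hasEnoughRootsOfUnity A ℂ]
  refine Nat.card_congr ((rootsOfUnityMulEquivOfIsCyclic Z).symm.monoidHomCongrRight.toEquiv.trans ?_)
  exact
    { toFun := fun f => (Subgroup.subtype _).comp f
      invFun := fun f => f.codRestrict _ fun a => by
        rw [mem_rootsOfUnity, ← map_pow, orderOf_dvd_iff_pow_eq_one.mp
          ((Monoid.order_dvd_exponent a).trans h), map_one]
      left_inv := fun f => rfl
      right_inv := fun f => rfl }

/-- Choose a complex character χ with χ(a ^ m) ≠ 1. Then χ ^ m is nontrivial at a, and the exponent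
bound puts its values among the |Z|-th roots of unity, a copy of Z. -/
theorem exists_monoidHom_apply_ne_one_of_isCyclic {A Z : Type*} [CommGroup A] [Finite A]
    [CommGroup Z] [Finite Z] [IsCyclic Z] {m : ℕ} (h : Monoid.exponent A ∣ m * Nat.card Z) {a : A}
    (ha : a ^ m ≠ 1) : ∃ f : A →* Z, f a ≠ 1 := by
  have : NeZero (Monoid.exponent A) := ⟨Monoid.exponent_ne_zero_of_finite⟩
  obtain ⟨χ, hχ⟩ := CommGroup.exists_apply_ne_one_of_hasEnoughRootsOfUnity A ℂ ha
  let ψ : A →* rootsOfUnity (Nat.card Z) ℂ := (χ ^ m).codRestrict _ fun a => by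
    rw [mem_rootsOfUnity, MonoidHom.pow_apply, ← pow_mul, ← map_pow, orderOf_dvd_iff_pow_eq_one.mp
          ((Monoid.order_dvd_exponent a).trans h), map_one]
  refine ⟨(rootsOfUnityMulEquivOfIsCyclic Z).toMonoidHom.comp ψ, ?_⟩
  intro hf
  have : ψ a = 1 := (rootsOfUnityMulEquivOfIsCyclic Z).injective (by simpa using hf)
  apply hχ
  have := congrArg Subtype.val this
  simpa [ψ] using this

instance MonoidHom.finite_of_finite {A Z : Type*} [MulOneClass A] [MulOneClass Z] [Finite A]
    [Finite Z] : Finite (A →* Z) :=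
  DFunLike.finite _

theorem card_monoidHom_le_of_surjective {A B Z : Type*} [Group A] [Finite A] [Group B]
    [Group Z] [Finite Z] (π : A →* B) (hπ : Function.Surjective π) :
    Nat.card (B →* Z) ≤ Nat.card (A →* Z) :=
  Nat.card_le_card_of_injective (fun f => f.comp π) fun _ _ h => (MonoidHom.cancel_right hπ).mp h

section ElementaryQuotient
variable {p : ℕ} [hp : Fact p.Prime] {A Z : Type*} [CommGroup A] [Finite A] [CommGroup Z] [Finite Z]

theorem IsPGroup.sq_dvd_card_monoidHom_quotient_range_pow (hA : IsPGroup p A) (h : ¬ IsCyclic A)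
    {u : Z} (hu : orderOf u = p) :
    p ^ 2 ∣ Nat.card ((A ⧸ (powMonoidHom p : A →* A).range) →* Subgroup.zpowers u) := by
  rw [card_monoidHom_of_isCyclic]
  · exact (hA.to_quotient _).sq_dvd_card_of_not_isCyclic (hA.not_isCyclic_quotient_range_pow h)
  · rw [Nat.card_zpowers, hu]
    refine Monoid.exponent_dvd_of_forall_pow_eq_one fun x => ?_
    obtain ⟨x, rfl⟩ := QuotientGroup.mk_surjective x
    rw [← QuotientGroup.mk_pow]
    exact (QuotientGroup.eq_one_iff _).mpr ⟨x, rfl⟩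

theorem IsPGroup.sq_le_card_monoidHom (hA : IsPGroup p A) (h : ¬ IsCyclic A)
    (hZ : IsPGroup p Z) [Nontrivial Z] : p ^ 2 ≤ Nat.card (A →* Z) := by
  obtain ⟨n, hn, hc⟩ := hZ.nontrivial_iff_card.mp inferInstance
  obtain ⟨u, hu⟩ := exists_prime_orderOf_dvd_card' p (hc ▸ dvd_pow_self p hn.ne')
  refine (Nat.le_of_dvd Nat.card_pos (hA.sq_dvd_card_monoidHom_quotient_range_pow h hu)).trans ?_
  refine le_trans ?_ (card_monoidHom_le_of_surjective (QuotientGroup.mk' (powMonoidHom p : A →* A).range)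
    (QuotientGroup.mk'_surjective _))
  exact Nat.card_le_card_of_injective (fun f => (Subgroup.subtype _).comp f) fun _ _ h =>
    (MonoidHom.cancel_left (Subgroup.subtype_injective _)).mp h

/-- The kernel of the p-th power map has the same order as Z/Zᵖ, which is at least p², so it is not
exhausted by one subgroup of order p. -/
theorem IsPGroup.exists_disjoint_zpowers (hZ : IsPGroup p Z) (h : ¬ IsCyclic Z) :
    ∃ u v : Z, orderOf u = p ∧ orderOf v = p ∧
      Disjoint (Subgroup.zpowers u) (Subgroup.zpowers v) := by
  set K := (powMonoidHom p : Z →* Z).ker with hK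
  have hcard : p ^ 2 ∣ Nat.card K := by
    have h1 := (hZ.to_quotient _).sq_dvd_card_of_not_isCyclic (hZ.not_isCyclic_quotient_range_pow h)
    have h2 := K.card_mul_index
    rw [hK, Subgroup.index_ker] at h2
    have h3 := (powMonoidHom p : Z →* Z).range.card_mul_index
    rw [← h2, mul_comm] at h3
    rwa [hK, ← Nat.eq_of_mul_eq_mul_right Nat.card_pos h3]
  have hle := Nat.le_of_dvd Nat.card_pos hcard
  have hlt : p < p ^ 2 := by
    nlinarith [hp.out.one_lt]
  have hord : ∀ u ∈ K, u ≠ 1 → orderOf u = p := fun u hu h => orderOf_eq_prime hu h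
  have hKb : K ≠ ⊥ := by
    intro hb
    rw [hb, Subgroup.card_bot] at hle
    have := hp.out.one_lt
    omega
  obtain ⟨⟨u, huK⟩, hu⟩ := Subgroup.ne_bot_iff_exists_ne_one.mp hKb
  have hu1 : u ≠ 1 := fun h => hu (Subtype.ext h)
  clear hu
  have hu := hord u huK hu1
  have hnle : ¬ K ≤ Subgroup.zpowers u := by
    intro hle'
    have := Subgroup.card_le_of_le hle'
    rw [Nat.card_zpowers, hu] at this
    omega
  obtain ⟨v, hvK, hv⟩ := SetLike.not_le_iff_exists.mp hnle
  have hv1 : v ≠ 1 := fun h => hv (h ▸ Subgroup.one_mem _)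
  refine ⟨u, v, hu, hord v hvK hv1, ?_⟩
  rw [Subgroup.disjoint_def]
  intro x hxu hxv
  by_contra hx
  apply hv
  have : Subgroup.zpowers x = Subgroup.zpowers v := by
    apply Subgroup.eq_of_le_of_card_ge (Subgroup.zpowers_le.mpr hxv)
    have hxK : x ∈ K := Subgroup.zpowers_le.mpr hvK hxv
    rw [Nat.card_zpowers, Nat.card_zpowers, hord x hxK hx, hord v hvK hv1]
  have hvx : v ∈ Subgroup.zpowers x := this ▸ Subgroup.mem_zpowers v
  exact Subgroup.zpowers_le.mpr hxu hvx

/-- Two independent subgroups of order p in Z each receive at least p² homomorphisms, and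
multiplying a pair of these loses no information. -/
theorem IsPGroup.pow_four_le_card_monoidHom (hA : IsPGroup p A) (h : ¬ IsCyclic A)
    (hZ : IsPGroup p Z) (hZc : ¬ IsCyclic Z) : p ^ 4 ≤ Nat.card (A →* Z) := by
  obtain ⟨u, v, hu, hv, huv⟩ := hZ.exists_disjoint_zpowers hZc
  refine le_trans ?_ (card_monoidHom_le_of_surjective (QuotientGroup.mk' (powMonoidHom p : A →* A).range)
    (QuotientGroup.mk'_surjective _))
  have h1 := Nat.le_of_dvd Nat.card_pos (hA.sq_dvd_card_monoidHom_quotient_range_pow h hu)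
  have h2 := Nat.le_of_dvd Nat.card_pos (hA.sq_dvd_card_monoidHom_quotient_range_pow h hv)
  calc p ^ 4 = p ^ 2 * p ^ 2 := by ring
    _ ≤ _ := Nat.mul_le_mul h1 h2
    _ = _ := (Nat.card_prod _ _).symm
    _ ≤ _ := Nat.card_le_card_of_injective
      (fun fg => ((Subgroup.subtype _).comp fg.1) * ((Subgroup.subtype _).comp fg.2)) ?_
  rintro ⟨f, g⟩ ⟨f', g'⟩ heq
  have key : ∀ x, (f x : Z) = f' x ∧ (g x : Z) = g' x := by
    intro x
    have hx : (f x : Z) * g x = f' x * g' x := DFunLike.congr_fun heq x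
    have hx' : (f' x : Z)⁻¹ * f x = g' x * (g x : Z)⁻¹ := by
      rw [inv_mul_eq_iff_eq_mul, ← mul_assoc, ← hx, mul_inv_cancel_right]
    have h1 : (f' x : Z)⁻¹ * f x = 1 := Subgroup.disjoint_def.mp huv
      (mul_mem (inv_mem (f' x).2) (f x).2) (hx' ▸ mul_mem (g' x).2 (inv_mem (g x).2))
    refine ⟨(inv_mul_eq_one.mp h1).symm, ?_⟩
    rw [h1] at hx'
    exact (mul_inv_eq_one.mp hx'.symm).symm
  exact Prod.ext (MonoidHom.ext fun x => Subtype.ext (key x).1)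
    (MonoidHom.ext fun x => Subtype.ext (key x).2)

/-- The quotient of A by p²-th powers already has enough homomorphisms: it is strictly larger than
A/Aᵖ, since otherwise Aᵖ would be p-divisible, hence trivial. -/
theorem IsPGroup.sq_lt_card_monoidHom (hA : IsPGroup p A) (h : ¬ IsCyclic A) [IsCyclic Z]
    (hZ : Nat.card Z = p ^ 2) (he : ¬ Monoid.exponent A ∣ p ^ 2) :
    p ^ 2 < Nat.card (A →* Z) := by
  refine lt_of_lt_of_le ?_ (card_monoidHom_le_of_surjective
    (QuotientGroup.mk' (powMonoidHom (p ^ 2) : A →* A).range) (QuotientGroup.mk'_surjective _))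
  rw [card_monoidHom_of_isCyclic]
  · have h1 := (hA.to_quotient _).sq_dvd_card_of_not_isCyclic (hA.not_isCyclic_quotient_range_pow h)
    refine (Nat.le_of_dvd Nat.card_pos h1).trans_lt ?_
    set R := (powMonoidHom p : A →* A).range with hR
    set R' := (powMonoidHom (p ^ 2) : A →* A).range with hR'
    have hle : R' ≤ R := by
      rintro _ ⟨x, rfl⟩
      exact ⟨x ^ p, by simp [← pow_mul, pow_two]⟩
    have hne : R' ≠ R := by
      intro heq
      have hs : Function.Surjective (fun x : R => x ^ p) := by
        rintro ⟨y, hy⟩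
        obtain ⟨x, hx⟩ := heq ▸ hy
        exact ⟨⟨x ^ p, x, rfl⟩, Subtype.ext (by simpa [← pow_mul, pow_two] using hx)⟩
      have hi := Finite.injective_iff_surjective.mpr hs
      have hR1 : ∀ k, ∀ y : R, y ^ p ^ k = 1 → y = 1 := by
        intro k
        induction k with
        | zero => simp
        | succ k ih =>
          intro y hy
          rw [pow_succ, pow_mul] at hy
          exact ih y (hi (by simpa using hy))
      apply he
      refine Monoid.exponent_dvd_of_forall_pow_eq_one fun x => ?_
      obtain ⟨k, hk⟩ := hA.to_subgroup R ⟨x ^ p, x, rfl⟩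
      have := congrArg Subtype.val (hR1 k _ hk)
      rw [pow_two, pow_mul]
      simp only [OneMemClass.coe_one] at this
      rw [this, one_pow]
    have h3 := Subgroup.relIndex_mul_index hle
    change R.index < R'.index
    rw [← h3]
    have hri : R'.relIndex R ≠ 1 := fun h => hne (le_antisymm hle (Subgroup.relIndex_eq_one.mp h))
    have hri0 : R'.relIndex R ≠ 0 := Subgroup.index_ne_zero_of_finite
    have : 0 < R.index := Nat.card_pos
    exact lt_mul_of_one_lt_left this (by omega)
  · rw [hZ]
    refine Monoid.exponent_dvd_of_forall_pow_eq_one fun x => ?_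
    obtain ⟨x, rfl⟩ := QuotientGroup.mk_surjective x
    rw [← QuotientGroup.mk_pow]
    exact (QuotientGroup.eq_one_iff _).mpr ⟨x, rfl⟩

theorem exponent_dvd_of_not_isCyclic {n : ℕ} (hA : Nat.card A = p ^ (n + 1)) (h : ¬ IsCyclic A) :
    Monoid.exponent A ∣ p ^ n := by
  obtain ⟨k, hk, hk'⟩ := (Nat.dvd_prime_pow hp.out).mp
    (hA ▸ Group.exponent_dvd_nat_card : Monoid.exponent A ∣ p ^ (n + 1))
  rw [hk']
  apply pow_dvd_pow
  by_contra! hlt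
  exact h (IsCyclic.of_exponent_eq_card (by rw [hk', hA, show k = n + 1 by omega]))

end ElementaryQuotient

/-! ### Central automorphisms as homomorphisms into the center. -/

section Automorphisms
variable {G : Type*} [Group G]

/-- Central automorphisms fixing the center correspond to homomorphisms `G ⧸ center G → center G`. -/
noncomputable def centralAutFixingCenterEquiv :
    centralAutFixingCenter G ≃ (G ⧸ Subgroup.center G →* Subgroup.center G) where
  toFun α := QuotientGroup.lift (Subgroup.center G)
    (MonoidHom.mk' (fun x => ⟨x⁻¹ * α.1 x, ((mem_centralAutFixingCenter_iff _).mp α.2).1 x⟩)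
      fun x y => Subtype.ext <| by
        have h := Subgroup.mem_center_iff.mp (((mem_centralAutFixingCenter_iff _).mp α.2).1 x) y⁻¹
        simp only [map_mul, mul_inv_rev, MulMemClass.mk_mul_mk]
        rw [← mul_assoc (y⁻¹ * x⁻¹), mul_assoc y⁻¹, h, mul_assoc])
    fun z hz => Subtype.ext <| by
      simp [((mem_centralAutFixingCenter_iff _).mp α.2).2 z hz]
  invFun f := ⟨
    { toFun := fun x => x * f x
      invFun := fun x => x * (f x)⁻¹
      left_inv := fun x => by
        simp
      right_inv := fun x => by
        simp
      map_mul' := fun x y => by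
        have := Subgroup.mem_center_iff.mp (f x).2 y
        simp only [QuotientGroup.mk_mul, map_mul, Subgroup.coe_mul]
        rw [mul_assoc x y, ← mul_assoc y, this]
        simp only [mul_assoc] },
    (mem_centralAutFixingCenter_iff _).mpr ⟨fun x => by simp, fun z hz => by
      have : (z : G ⧸ Subgroup.center G) = 1 := (QuotientGroup.eq_one_iff _).mpr hz
      simp [this]⟩⟩
  left_inv α := Subtype.ext <| MulEquiv.ext fun x => mul_inv_cancel_left x (α.1 x)
  right_inv f := MonoidHom.ext fun x => by
    obtain ⟨x, rfl⟩ := QuotientGroup.mk_surjective x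
    exact Subtype.ext (by simp)

theorem centralAutFixingCenterEquiv_apply (α : centralAutFixingCenter G) (x : G) :
    (centralAutFixingCenterEquiv α x : G) = x⁻¹ * α.1 x := rfl

theorem ker_mulAut_conj : (MulAut.conj : G →* MulAut G).ker = Subgroup.center G := by
  ext x
  rw [MonoidHom.mem_ker, Subgroup.mem_center_iff, MulEquiv.ext_iff]
  refine forall_congr' fun y => ?_
  rw [MulAut.conj_apply, MulAut.one_apply, mul_inv_eq_iff_eq_mul, eq_comm]

noncomputable def quotientCenterEquivInnerAut : G ⧸ Subgroup.center G ≃* innerAut G :=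
  (QuotientGroup.quotientMulEquivOfEq ker_mulAut_conj.symm).trans
    (QuotientGroup.quotientKerEquivRange MulAut.conj)

theorem card_centerInnerAut :
    Nat.card (centerInnerAut G) = Nat.card (Subgroup.center (G ⧸ Subgroup.center G)) := by
  rw [centerInnerAut, Subgroup.card_map_of_injective (Subgroup.subtype_injective _)]
  exact Nat.card_congr (Subgroup.centerCongr quotientCenterEquivInnerAut.symm).toEquiv

theorem exists_conj_eq_of_mem_centerInnerAut {α : MulAut G} (hα : α ∈ centerInnerAut G) :
    ∃ x : G, (x : G ⧸ Subgroup.center G) ∈ Subgroup.center (G ⧸ Subgroup.center G) ∧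
      MulAut.conj x = α := by
  obtain ⟨⟨_, x, rfl⟩, hβ, rfl⟩ := hα
  refine ⟨x, ?_, rfl⟩
  rw [Subgroup.mem_center_iff]
  intro y
  obtain ⟨y, rfl⟩ := QuotientGroup.mk_surjective y
  have := Subgroup.mem_center_iff.mp hβ ⟨MulAut.conj y, y, rfl⟩
  apply (quotientCenterEquivInnerAut (G := G)).injective
  rw [map_mul, map_mul]
  exact this

theorem centerInnerAut_le_centralAutFixingCenter :
    centerInnerAut G ≤ centralAutFixingCenter G := by
  intro α hα
  obtain ⟨x, hx, rfl⟩ := exists_conj_eq_of_mem_centerInnerAut hα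
  rw [mem_centralAutFixingCenter_iff]
  constructor
  · intro y
    rw [← QuotientGroup.eq_one_iff]
    have := Subgroup.mem_center_iff.mp hx y
    simp only [MulAut.conj_apply, QuotientGroup.mk_mul, QuotientGroup.mk_inv]
    rw [← this]; simp
  · intro z hz
    rw [MulAut.conj_apply, Subgroup.mem_center_iff.mp hz x, mul_inv_cancel_right]

theorem centerInnerAut_eq_iff_card [Finite G] :
    centerInnerAut G = centralAutFixingCenter G ↔
      Nat.card (Subgroup.center (G ⧸ Subgroup.center G)) =
        Nat.card (G ⧸ Subgroup.center G →* Subgroup.center G) := by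
  have : Finite (MulAut G) := DFunLike.finite _
  rw [← card_centerInnerAut, ← Nat.card_congr centralAutFixingCenterEquiv]
  exact ⟨fun h => by rw [h], fun h =>
    Subgroup.eq_of_le_of_card_ge centerInnerAut_le_centralAutFixingCenter h.ge⟩

theorem exists_conj_of_centerInnerAut_eq (h : centerInnerAut G = centralAutFixingCenter G)
    (f : G ⧸ Subgroup.center G →* Subgroup.center G) :
    ∃ x : G, (x : G ⧸ Subgroup.center G) ∈ Subgroup.center (G ⧸ Subgroup.center G) ∧
      ∀ y : G, (f y : G) = y⁻¹ * (x * y * x⁻¹) := by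
  obtain ⟨α, rfl⟩ := centralAutFixingCenterEquiv.surjective f
  obtain ⟨x, hx, hα⟩ := exists_conj_eq_of_mem_centerInnerAut (h.ge α.2)
  exact ⟨x, hx, fun y => by rw [centralAutFixingCenterEquiv_apply, ← hα, MulAut.conj_apply]⟩

/-- Conjugation by x multiplies y by the central element t, so conjugation by x ^ n multiplies it by
t ^ n. -/
theorem pow_eq_one_of_commute_pow {x y t : G} {n : ℕ} (ht : t ∈ Subgroup.center G)
    (h : x * y * x⁻¹ = y * t) (hc : Commute (x ^ n) y) : t ^ n = 1 := by
  have key : ∀ k : ℕ, x ^ k * y = y * t ^ k * x ^ k := by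
    intro k
    induction k with
    | zero => simp
    | succ k ih =>
      have hx : x * y = y * t * x := by rw [← h, inv_mul_cancel_right]
      have htk := Subgroup.mem_center_iff.mp (pow_mem ht k) x
      rw [pow_succ', mul_assoc, ih, ← mul_assoc, ← mul_assoc, hx, mul_assoc (y * t) x, htk,
        pow_succ' t]
      simp only [mul_assoc]
  have := (key n).symm.trans hc
  rw [mul_assoc, mul_right_inj] at this
  simpa using this

/-- Injectivity need only be tested on the center, because x * f x = 1 already makes x central. -/
theorem exists_mulAut_of_monoidHom_center [Finite G] (f : G →* Subgroup.center G)
    (hf : ∀ z ∈ Subgroup.center G, z * f z = 1 → z = 1) :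
    ∃ α ∈ centralAut G, ∀ x, α x = x * f x := by
  let φ : G →* G := MonoidHom.mk' (fun x => x * f x) fun x y => by
    have := Subgroup.mem_center_iff.mp (f x).2 y
    simp only [map_mul, Subgroup.coe_mul]
    rw [mul_assoc x y, ← mul_assoc y, this]
    simp only [mul_assoc]
  have hinj : Function.Injective φ := by
    rw [injective_iff_map_eq_one]
    intro x hx
    refine hf x ?_ hx
    rw [eq_inv_of_mul_eq_one_left hx]
    exact inv_mem (f x).2
  let α : MulAut G := MulEquiv.ofBijective φ (Finite.injective_iff_bijective.mp hinj)
  have hα : ∀ x, α x = x * f x := fun x => rfl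
  exact ⟨α, (mem_centralAut_iff α).mpr fun x => by simp [hα], hα⟩

end Automorphisms

/-! ### Commutator subgroups, centers and quotients. -/

theorem commutator_inf_center_ne_bot {G : Type*} [Group G] [Group.IsNilpotent G]
    (h : ¬ IsMulCommutative G) : commutator G ⊓ Subgroup.center G ≠ ⊥ := by
  have hc : 2 ≤ Group.nilpotencyClass G := by
    by_contra! hlt
    exact h (Group.IsNilpotent.nilpotencyClass_le_one_iff.mp (by omega))
  obtain ⟨n, hn⟩ := Nat.exists_eq_add_of_le hc
  -- The class is n + 2 and the series starts with ⊤ at index 0, so this is its last nontrivial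
  -- term.
  set L := (⊤ : Subgroup G).lowerCentralSeries (n + 1) with hL
  have h1 : L ≤ Subgroup.center G := by
    rw [← Subgroup.commutator_top_right_eq_bot_iff_le_center, hL,
      ← Subgroup.lowerCentralSeries_succ, Subgroup.lowerCentralSeries_eq_bot_iff_nilpotencyClass_le]
    omega
  have h2 : L ≤ commutator G := by
    rw [← Subgroup.top_lowerCentralSeries_one]
    exact Subgroup.lowerCentralSeries_antitone _ (by omega)
  intro hb
  have : L = ⊥ := le_bot_iff.mp (hb ▸ le_inf h2 h1)
  rw [Subgroup.lowerCentralSeries_eq_bot_iff_nilpotencyClass_le] at this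
  omega

theorem isMulCommutative_quotient_center_iff {G : Type*} [Group G] :
    IsMulCommutative (G ⧸ Subgroup.center G) ↔ commutator G ≤ Subgroup.center G :=
  Subgroup.Normal.quotient_commutative_iff_commutator_le

theorem map_mk'_commutator {G : Type*} [Group G] (N : Subgroup G) [N.Normal] :
    (commutator G).map (QuotientGroup.mk' N) = commutator (G ⧸ N) := by
  rw [commutator_def, Subgroup.map_commutator,
    Subgroup.map_top_of_surjective _ (QuotientGroup.mk'_surjective N), commutator_def]

theorem card_commutator_eq_mul {G : Type*} [Group G] (N : Subgroup G) [N.Normal] :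
    Nat.card (commutator G) =
      Nat.card (commutator (G ⧸ N)) * Nat.card (commutator G ⊓ N : Subgroup G) := by
  have h1 := Subgroup.relIndex_mul_relIndex (⊥ : Subgroup G) (commutator G ⊓ N) (commutator G)
    bot_le inf_le_left
  rw [Subgroup.relIndex_bot_left, Subgroup.relIndex_bot_left, inf_comm,
    Subgroup.inf_relIndex_right] at h1
  have h2 := Subgroup.relIndex_ker (commutator G) (QuotientGroup.mk' N)
  rw [QuotientGroup.ker_mk', map_mk'_commutator] at h2
  rw [← h1, h2, mul_comm, inf_comm]

theorem card_abelianization_mul_card_commutator (G : Type*) [Group G] :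
    Nat.card (Abelianization G) * Nat.card (commutator G) = Nat.card G :=
  (Subgroup.card_eq_card_quotient_mul_card_subgroup (commutator G)).symm

theorem card_abelianization_quotient_le {G : Type*} [Group G] [Finite G] (N : Subgroup G) [N.Normal] :
    Nat.card (Abelianization (G ⧸ N)) ≤ Nat.card (Abelianization G) := by
  refine Nat.card_le_card_of_surjective (Abelianization.map (QuotientGroup.mk' N)) fun y => ?_
  obtain ⟨y, rfl⟩ := QuotientGroup.mk_surjective y
  obtain ⟨x, rfl⟩ := QuotientGroup.mk_surjective y
  exact ⟨Abelianization.of x, rfl⟩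

theorem card_monoidHom_abelianization (H Z : Type*) [Group H] [CommGroup Z] :
    Nat.card (H →* Z) = Nat.card (Abelianization H →* Z) :=
  Nat.card_congr Abelianization.lift

instance Abelianization.finite_of_finite (G : Type*) [Group G] [Finite G] :
    Finite (Abelianization G) :=
  inferInstanceAs (Finite (G ⧸ commutator G))

/-! ### Centers and classes of small p-groups. -/

section PGroup
open scoped IsMulCommutative
variable {p : ℕ} [hp : Fact p.Prime] {G : Type*} [Group G]

theorem isMulCommutative_of_card_dvd_sq [Finite G] (h : Nat.card G ∣ p ^ 2) :
    IsMulCommutative G := by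
  by_contra hc
  have hG : IsPGroup p G := IsPGroup.of_card_dvd_pow h
  have h1 := hG.sq_dvd_index_center hc
  have h2 := (Subgroup.center G).card_mul_index
  have h3 : Nat.card G = p ^ 2 :=
    Nat.dvd_antisymm h (h1.trans (Dvd.intro_left _ h2))
  exact hc (IsPGroup.isMulCommutative_of_card_eq_prime_sq h3)

/-- In a group of order `p ^ 4` and class two, the commutator subgroup has index at least `p ^ 3`. -/
theorem not_card_abelianization_le_sq (hG : Nat.card G = p ^ 4) (hc : ¬ IsMulCommutative G)
    (hle : commutator G ≤ Subgroup.center G) : ¬ Nat.card (Abelianization G) ≤ p ^ 2 := by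
  intro h
  have hpp := hp.out
  have : Finite G := Nat.finite_of_card_ne_zero (by rw [hG]; exact (pow_pos hpp.pos 4).ne')
  have h1 := (IsPGroup.of_card hG).sq_dvd_index_center hc
  have h2 : (Subgroup.center G).index ≤ (commutator G).index :=
    Nat.le_of_dvd Nat.card_pos (Subgroup.index_dvd_of_le hle)
  have h3 : (Subgroup.center G).index = p ^ 2 :=
    le_antisymm (h2.trans h) (Nat.le_of_dvd Nat.card_pos h1)
  have h4 := card_commutator_of_index_center_eq_sq h3
  have h5 := card_abelianization_mul_card_commutator G
  rw [h4, hG, pow_succ p 3] at h5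
  have h6 := Nat.eq_of_mul_eq_mul_right hpp.pos h5
  have := Nat.pow_lt_pow_right hpp.one_lt (show 2 < 3 by omega)
  omega

/-- G/Z(G) is nonabelian, so |Z(G)| ≤ p². Were |Z(G)| = p, then G/Z(G) would have order p⁴, class
two and abelianization of order at most p², against `not_card_abelianization_le_sq`. -/
theorem card_center_of_nilpotencyClass_three (hG : Nat.card G = p ^ 5)
    (hc : Group.nilpotencyClass G = 3) (hA : Nat.card (Abelianization G) = p ^ 2) :
    Nat.card (Subgroup.center G) = p ^ 2 := by
  have hpp := hp.out
  have : Finite G := Nat.finite_of_card_ne_zero (by rw [hG]; exact (pow_pos hpp.pos 5).ne')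
  have hP : IsPGroup p G := IsPGroup.of_card hG
  have := hP.isNilpotent
  have hQP : IsPGroup p (G ⧸ Subgroup.center G) := hP.to_quotient _
  have := hQP.isNilpotent
  have hQ2 : Group.nilpotencyClass (G ⧸ Subgroup.center G) = 2 := by
    rw [Group.nilpotencyClass_quotient_center, hc]
  have hQc : ¬ IsMulCommutative (G ⧸ Subgroup.center G) := by
    rw [← Group.IsNilpotent.nilpotencyClass_le_one_iff]; omega
  obtain ⟨k, hk, hZ⟩ := (Nat.dvd_prime_pow hpp).mp (hG ▸ (Subgroup.center G).card_subgroup_dvd_card)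
  have hcard := (Subgroup.center G).card_mul_index
  have hQ : Nat.card (G ⧸ Subgroup.center G) = p ^ (5 - k) := by
    apply Nat.eq_of_mul_eq_mul_left (pow_pos hpp.pos k)
    rw [← pow_add, Nat.add_sub_cancel' hk, ← hG, ← hcard, hZ]; rfl
  have hk2 : k ≤ 2 := by
    by_contra! hlt
    exact hQc (isMulCommutative_of_card_dvd_sq (p := p) (hQ ▸ pow_dvd_pow p (by omega)))
  have hk0 : k ≠ 0 := by
    rintro rfl
    have : Nontrivial G := Finite.one_lt_card_iff_nontrivial.mp
      (hG ▸ Nat.one_lt_pow (by omega) hpp.one_lt)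
    exact hP.bot_lt_center.ne' (Subgroup.card_eq_one.mp (by simpa using hZ))
  have hk1 : k ≠ 1 := by
    rintro rfl
    have hle : commutator (G ⧸ Subgroup.center G) ≤ Subgroup.center (G ⧸ Subgroup.center G) := by
      rw [← isMulCommutative_quotient_center_iff,
        ← Group.IsNilpotent.nilpotencyClass_le_one_iff, Group.nilpotencyClass_quotient_center]
      omega
    exact not_card_abelianization_le_sq hQ hQc hle
      (hA ▸ card_abelianization_quotient_le (Subgroup.center G))
  rw [hZ, show k = 2 by omega]

theorem nilpotencyClass_eq_three_of_card_center (hG : Nat.card G = p ^ 5)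
    (hZ : Nat.card (Subgroup.center G) = p ^ 2) (hA : Nat.card (commutator G) = p ^ 3) :
    Group.nilpotencyClass G = 3 := by
  have hpp := hp.out
  have : Finite G := Nat.finite_of_card_ne_zero (by rw [hG]; exact (pow_pos hpp.pos 5).ne')
  have hP : IsPGroup p G := IsPGroup.of_card hG
  have := hP.isNilpotent
  have hQP : IsPGroup p (G ⧸ Subgroup.center G) := hP.to_quotient _
  have := hQP.isNilpotent
  set Q := G ⧸ Subgroup.center G
  have hcard := (Subgroup.center G).card_mul_index
  have hQ : Nat.card Q = p ^ 3 := by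
    apply Nat.eq_of_mul_eq_mul_left (pow_pos hpp.pos 2)
    rw [← pow_add, ← hG, ← hcard, hZ]; rfl
  have hQc : ¬ IsMulCommutative Q := by
    rw [isMulCommutative_quotient_center_iff]
    intro hle
    have := Subgroup.card_le_of_le hle
    rw [hA, hZ] at this
    exact absurd ((Nat.pow_le_pow_iff_right hpp.one_lt).mp this) (by omega)
  have hQQ : IsMulCommutative (Q ⧸ Subgroup.center Q) := by
    apply isMulCommutative_of_card_dvd_sq (p := p)
    have hQnt : Nontrivial Q := Finite.one_lt_card_iff_nontrivial.mp
      (hQ ▸ Nat.one_lt_pow (by omega) hpp.one_lt)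
    have hb := hQP.bot_lt_center.ne'
    have hc := (Subgroup.center Q).card_mul_index
    obtain ⟨k, hk, hk'⟩ := (Nat.dvd_prime_pow hpp).mp (hQ ▸ Dvd.intro_left _ hc)
    change (Subgroup.center Q).index ∣ _
    rw [hk']
    apply pow_dvd_pow
    by_contra! hlt
    rw [hk', hQ, show k = 3 by omega] at hc
    exact hb (Subgroup.card_eq_one.mp (Nat.eq_of_mul_eq_mul_right (pow_pos hpp.pos 3)
      (hc.trans (one_mul _).symm)))
  have hn : Group.IsNilpotent (Q ⧸ Subgroup.center Q) := inferInstance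
  rw [← Group.IsNilpotent.nilpotencyClass_le_one_iff] at hQQ hQc
  rw [Group.nilpotencyClass_quotient_center] at hQQ hQc
  rw [Group.nilpotencyClass_quotient_center] at hQQ
  omega

/-- If the center is cyclic of order `p ^ 2` and every homomorphism `G ⧸ Z(G) → Z(G)` comes from
an inner automorphism, then `G ⧸ Z(G)` cannot have a center of index `p ^ 2` and order `p ^ 3`
while its abelianization has exponent exactly `p ^ 3`. -/
theorem exponent_dvd_of_centerInnerAut_eq [Finite G]
    [IsCyclic (Subgroup.center G)] (hZ : Nat.card (Subgroup.center G) = p ^ 2)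
    (heq : centerInnerAut G = centralAutFixingCenter G)
    (hZH : Nat.card (Subgroup.center (G ⧸ Subgroup.center G)) = p ^ 3)
    (hZi : (Subgroup.center (G ⧸ Subgroup.center G)).index = p ^ 2)
    (he : Monoid.exponent (Abelianization (G ⧸ Subgroup.center G)) ∣ p ^ 3) :
    Monoid.exponent (Abelianization (G ⧸ Subgroup.center G)) ∣ p ^ 2 := by
  have hpp := hp.out
  refine Monoid.exponent_dvd_of_forall_pow_eq_one fun α => ?_
  by_contra hα
  -- If α ^ p² ≠ 1, some f satisfies f(α) ^ p ≠ 1. It is induced by conjugation by some x, and the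
  -- aim is to show that x ^ p commutes with a lift a of α.
  obtain ⟨f, hf⟩ := exists_monoidHom_apply_ne_one_of_isCyclic (Z := Subgroup.center G) (m := p)
    (a := α ^ p) (by rwa [hZ, ← pow_succ']) (by rwa [← pow_mul, ← pow_two])
  obtain ⟨b, rfl⟩ := QuotientGroup.mk_surjective α
  obtain ⟨a, rfl⟩ := QuotientGroup.mk_surjective b
  change Abelianization.of _ ^ _ ≠ 1 at hα
  change f (Abelianization.of _ ^ _) ≠ 1 at hf
  obtain ⟨x, hx, hxf⟩ := exists_conj_of_centerInnerAut_eq heq (f.comp Abelianization.of)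
  set H := G ⧸ Subgroup.center G with hH
  have hap : (a : H) ^ p ∈ Subgroup.center H := pow_mem_center_of_index_eq_sq hZi _
  set C := Subgroup.zpowers (⟨(a : H) ^ p, hap⟩ : Subgroup.center H) with hC
  have hCn : ∀ n : ℕ, ((a : H) ^ p) ^ n = 1 → Abelianization.of (a : H) ^ (p * n) = 1 := by
    intro n h
    rw [← map_pow, pow_mul, h, map_one]
  have hCcard : p ^ 2 ∣ Nat.card C := by
    rw [hC, Nat.card_zpowers, Subgroup.orderOf_mk]
    obtain ⟨k, hk, hk'⟩ := (Nat.dvd_prime_pow hpp).mp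
      (show orderOf ((a : H) ^ p) ∣ p ^ 3 from hZH ▸ Subgroup.orderOf_dvd_natCard _ hap)
    rw [hk']
    apply pow_dvd_pow
    by_contra! hlt
    apply hα
    have : ((a : H) ^ p) ^ p = 1 := by
      rw [← orderOf_dvd_iff_pow_eq_one, hk']
      exact (pow_dvd_pow p (show k ≤ 1 by omega)).trans (pow_one p).dvd
    simpa [pow_two] using hCn p this
  -- Z(H) has order p³ and a ^ p has order at least p² in it, so x ^ p lies in ⟨a ^ p⟩ modulo Z(G).
  have hCi : C.index ∣ p := by
    obtain ⟨m, hm⟩ := hCcard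
    have h1 := C.card_mul_index
    rw [hZH, hm, pow_succ p 2, mul_assoc] at h1
    exact Dvd.intro_left _ (Nat.eq_of_mul_eq_mul_left (pow_pos hpp.pos 2) h1)
  have hxC : (⟨(x : H), hx⟩ : Subgroup.center H) ^ p ∈ C := by
    have hq : ((⟨(x : H), hx⟩ : Subgroup.center H) : Subgroup.center H ⧸ C) ^ p = 1 :=
      orderOf_dvd_iff_pow_eq_one.mp ((orderOf_dvd_natCard _).trans hCi)
    rwa [← QuotientGroup.mk_pow, QuotientGroup.eq_one_iff] at hq
  obtain ⟨k, hk⟩ := Subgroup.mem_zpowers_iff.mp hxC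
  have hk2 : (((a ^ p) ^ k : G) : H) = ((x ^ p : G) : H) := by
    simpa using congrArg Subtype.val hk
  have hz := QuotientGroup.eq.mp hk2
  have hcomm : Commute (x ^ p) a := by
    have h1 : x ^ p = (a ^ p) ^ k * (((a ^ p) ^ k)⁻¹ * x ^ p) := (mul_inv_cancel_left _ _).symm
    rw [h1]
    exact (((Commute.refl a).pow_left p).zpow_left k).mul_left
      (Subgroup.mem_center_iff.mp hz a).symm
  have hfa := hxf a
  have ht := pow_eq_one_of_commute_pow (f (Abelianization.of (a : H))).2
    (x := x) (y := a) (n := p) (by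
      change ((f (Abelianization.of (a : H)) : Subgroup.center G) : G) = _ at hfa
      rw [hfa, mul_inv_cancel_left]) hcomm
  apply hf
  rw [map_pow]
  exact Subtype.ext (by simpa using ht)

end PGroup

/-! ### Groups of order p⁷. -/

theorem IsCyclic.mem_of_pow_card_eq_one {Z : Type*} [CommGroup Z] [Finite Z] [IsCyclic Z]
    (I : Subgroup Z) {x : Z} (hx : x ^ Nat.card I = 1) : x ∈ I := by
  have hle : I ≤ (powMonoidHom (Nat.card I) : Z →* Z).ker := fun y hy =>
    congrArg Subtype.val (pow_card_eq_one' (x := (⟨y, hy⟩ : I)))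
  have : I = (powMonoidHom (Nat.card I) : Z →* Z).ker := Subgroup.eq_of_le_of_card_ge hle (by
    rw [IsCyclic.card_powMonoidHom_ker, Nat.gcd_eq_right I.card_subgroup_dvd_card])
  rw [this]
  exact hx

section Main
open scoped IsMulCommutative
variable {p : ℕ} [hp : Fact p.Prime] {G : Type*} [Group G]

theorem card_commutator_inf_center [Finite G] (hP : IsPGroup p G) (hc : ¬ IsMulCommutative G)
    (hZ : ¬ Subgroup.center G ≤ commutator G) :
    ∃ k ≥ 1, Nat.card (commutator G ⊓ Subgroup.center G : Subgroup G) = p ^ k ∧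
      p ^ (k + 1) ∣ Nat.card (Subgroup.center G) := by
  have hpp := hp.out
  have := hP.isNilpotent
  have hb := commutator_inf_center_ne_bot hc
  set I := commutator G ⊓ Subgroup.center G with hI
  obtain ⟨k, hk⟩ := IsPGroup.iff_card.mp (hP.to_subgroup I)
  obtain ⟨n, hn⟩ := IsPGroup.iff_card.mp (hP.to_subgroup (Subgroup.center G))
  refine ⟨k, ?_, hk, ?_⟩
  · by_contra! hlt
    exact hb (Subgroup.card_eq_one.mp (by rw [hk, show k = 0 by omega, pow_zero]))
  · rw [hn]
    apply pow_dvd_pow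
    by_contra! hlt
    have : I = Subgroup.center G := Subgroup.eq_of_le_of_card_ge inf_le_right
      (by rw [hk, hn]; exact Nat.pow_le_pow_right hpp.pos (by omega))
    exact hZ (this ▸ inf_le_left)

theorem card_quotient_center {n k : ℕ} (hG : Nat.card G = p ^ (n + k))
    (hZ : Nat.card (Subgroup.center G) = p ^ k) : Nat.card (G ⧸ Subgroup.center G) = p ^ n := by
  have h := (Subgroup.center G).card_mul_index
  apply Nat.eq_of_mul_eq_mul_left (pow_pos hp.out.pos k)
  rw [← hZ]
  exact h.trans (by rw [hG, hZ, ← pow_add, add_comm])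

theorem index_center_of_card {n k : ℕ} (hG : Nat.card G = p ^ (n + k))
    (hZ : Nat.card (Subgroup.center G) = p ^ k) : (Subgroup.center G).index = p ^ n :=
  card_quotient_center hG hZ

theorem card_abelianization_of_card_commutator {n k : ℕ} (hG : Nat.card G = p ^ (n + k))
    (hZ : Nat.card (commutator G) = p ^ k) : Nat.card (Abelianization G) = p ^ n := by
  have h := card_abelianization_mul_card_commutator G
  apply Nat.eq_of_mul_eq_mul_right (pow_pos hp.out.pos k)
  rw [← pow_add, ← hG, ← h, hZ]

theorem card_center_of_centerInnerAut_eq [Finite G] (hG : Nat.card G = p ^ 7)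
    (hclass : 3 ≤ Group.nilpotencyClass G) (hZ : ¬ Subgroup.center G ≤ commutator G)
    (heq : centerInnerAut G = centralAutFixingCenter G) :
    IsCyclic (Subgroup.center G) ∧ Nat.card (Subgroup.center G) = p ^ 2 := by
  have hpp := hp.out
  have hP : IsPGroup p G := IsPGroup.of_card hG
  have := hP.isNilpotent
  have hGc : ¬ IsMulCommutative G := by
    rw [← Group.IsNilpotent.nilpotencyClass_le_one_iff]; omega
  obtain ⟨k, hk, -, hkZ⟩ := card_commutator_inf_center hP hGc hZ
  obtain ⟨a, ha, hca⟩ := (Nat.dvd_prime_pow hpp).mp (hG ▸ (Subgroup.center G).card_subgroup_dvd_card)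
  have ha2 : k + 1 ≤ a := (Nat.pow_dvd_pow_iff_le_right hpp.one_lt).mp (hca ▸ hkZ)
  have hZP := hP.to_subgroup (Subgroup.center G)
  have hZnt : Nontrivial (Subgroup.center G) := Finite.one_lt_card_iff_nontrivial.mp
    (hca ▸ Nat.one_lt_pow (by omega) hpp.one_lt)
  have hHP : IsPGroup p (G ⧸ Subgroup.center G) := hP.to_quotient _
  have hHcard : Nat.card (G ⧸ Subgroup.center G) = p ^ (7 - a) :=
    card_quotient_center (by rw [hG, Nat.sub_add_cancel ha]) hca
  have := hHP.isNilpotent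
  have hHc : ¬ IsMulCommutative (G ⧸ Subgroup.center G) := by
    rw [← Group.IsNilpotent.nilpotencyClass_le_one_iff, Group.nilpotencyClass_quotient_center]
    omega
  rw [centerInnerAut_eq_iff_card, card_monoidHom_abelianization] at heq
  set H := G ⧸ Subgroup.center G with hH
  have hAP : IsPGroup p (Abelianization H) := hHP.to_quotient _
  have hAc := hHP.not_isCyclic_abelianization hHc
  obtain ⟨b, hb, hcb⟩ := (Nat.dvd_prime_pow hpp).mp
    (hHcard ▸ (Subgroup.center H).card_subgroup_dvd_card)
  have hi := index_center_of_card (p := p) (n := 7 - a - b) (by rw [hHcard, Nat.sub_add_cancel hb]) hcb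
  have hab : 2 ≤ 7 - a - b :=
    (Nat.pow_dvd_pow_iff_le_right hpp.one_lt).mp (hi ▸ hHP.sq_dvd_index_center hHc)
  rw [hcb] at heq
  have hb2 : 2 ≤ b := (Nat.pow_le_pow_iff_right hpp.one_lt).mp
    (heq ▸ hAP.sq_le_card_monoidHom hAc hZP)
  have hcyc : IsCyclic (Subgroup.center G) := by
    by_contra hnc
    -- This contradicts a ≥ 2 and a + b ≤ 5.
    have : 4 ≤ b := (Nat.pow_le_pow_iff_right hpp.one_lt).mp
      (heq ▸ hAP.pow_four_le_card_monoidHom hAc hZP hnc)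
    omega
  refine ⟨hcyc, ?_⟩
  rw [hca]
  by_contra hne
  have ha3 : a = 3 := by
    have : a ≠ 2 := fun h => hne (by rw [h])
    omega
  have hb2' : b = 2 := by omega
  subst ha3 hb2'
  have hA := card_abelianization_of_card_commutator (p := p) (n := 3) (k := 1) hHcard
    (by rw [card_commutator_of_index_center_eq_sq hi, pow_one])
  rw [card_monoidHom_of_isCyclic _ _ ((exponent_dvd_of_not_isCyclic hA hAc).trans
    (hca ▸ pow_dvd_pow p (by omega))), hA] at heq
  exact absurd (Nat.pow_right_injective hpp.two_le heq) (by omega)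

theorem card_commutator_and_class_of_centerInnerAut_eq [Finite G] (hG : Nat.card G = p ^ 7)
    (hclass : 3 ≤ Group.nilpotencyClass G) (hZ : ¬ Subgroup.center G ≤ commutator G)
    (heq : centerInnerAut G = centralAutFixingCenter G) [IsCyclic (Subgroup.center G)]
    (hca : Nat.card (Subgroup.center G) = p ^ 2) :
    Nat.card (commutator G) = p ^ 4 ∧ Group.nilpotencyClass G = 4 := by
  have hpp := hp.out
  have hP : IsPGroup p G := IsPGroup.of_card hG
  have := hP.isNilpotent
  have hGc : ¬ IsMulCommutative G := by
    rw [← Group.IsNilpotent.nilpotencyClass_le_one_iff]; omega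
  obtain ⟨k, hk, hkI, hkZ⟩ := card_commutator_inf_center hP hGc hZ
  have hk2 : k + 1 ≤ 2 := (Nat.pow_dvd_pow_iff_le_right hpp.one_lt).mp (hca ▸ hkZ)
  obtain rfl : k = 1 := by omega
  have hHP : IsPGroup p (G ⧸ Subgroup.center G) := hP.to_quotient _
  have hHcard : Nat.card (G ⧸ Subgroup.center G) = p ^ 5 := card_quotient_center hG hca
  have := hHP.isNilpotent
  have hHc : ¬ IsMulCommutative (G ⧸ Subgroup.center G) := by
    rw [← Group.IsNilpotent.nilpotencyClass_le_one_iff, Group.nilpotencyClass_quotient_center]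
    omega
  have hexp := exponent_dvd_of_centerInnerAut_eq hca heq
  rw [centerInnerAut_eq_iff_card, card_monoidHom_abelianization] at heq
  have hcomm := card_commutator_eq_mul (Subgroup.center G)
  have hcl := Group.nilpotencyClass_quotient_center (G := G)
  set H := G ⧸ Subgroup.center G with hH
  have hAP : IsPGroup p (Abelianization H) := hHP.to_quotient _
  have hAc := hHP.not_isCyclic_abelianization hHc
  obtain ⟨b, hb, hcb⟩ := (Nat.dvd_prime_pow hpp).mp
    (hHcard ▸ (Subgroup.center H).card_subgroup_dvd_card)
  have hi := index_center_of_card (p := p) (n := 5 - b) (by rw [hHcard, Nat.sub_add_cancel hb]) hcb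
  have hab : 2 ≤ 5 - b :=
    (Nat.pow_dvd_pow_iff_le_right hpp.one_lt).mp (hi ▸ hHP.sq_dvd_index_center hHc)
  rw [hcb] at heq
  have hb2 : b = 2 := by
    have hZnt : Nontrivial (Subgroup.center G) := Finite.one_lt_card_iff_nontrivial.mp
      (hca ▸ Nat.one_lt_pow (by omega) hpp.one_lt)
    have hb2 : 2 ≤ b := (Nat.pow_le_pow_iff_right hpp.one_lt).mp
      (heq ▸ hAP.sq_le_card_monoidHom hAc (hP.to_subgroup _))
    by_contra hne
    -- Here |Hᵃᵇ| = p⁴ with exponent dividing p² = |Z(G)|, giving p⁴ homomorphisms against |Z(H)| =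
    -- p³.
    obtain rfl : b = 3 := by omega
    have hA := card_abelianization_of_card_commutator (p := p) (n := 4) (k := 1) hHcard
      (by rw [card_commutator_of_index_center_eq_sq hi, pow_one])
    rw [card_monoidHom_of_isCyclic _ _
      (hca ▸ hexp hcb hi (exponent_dvd_of_not_isCyclic hA hAc)), hA] at heq
    exact absurd (Nat.pow_right_injective hpp.two_le heq) (by omega)
  subst hb2
  have hexp2 : Monoid.exponent (Abelianization H) ∣ p ^ 2 := by
    by_contra hne
    exact (hAP.sq_lt_card_monoidHom hAc hca hne).ne heq
  rw [card_monoidHom_of_isCyclic _ _ (hca ▸ hexp2)] at heq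
  have hHcomm : Nat.card (commutator H) = p ^ 3 := by
    have h := card_abelianization_mul_card_commutator H
    apply Nat.eq_of_mul_eq_mul_left (pow_pos hpp.pos 2)
    rw [← pow_add, ← hHcard, ← h, heq]
  refine ⟨by rw [hcomm, hHcomm, hkI, ← pow_add], ?_⟩
  rw [nilpotencyClass_eq_three_of_card_center hHcard hcb hHcomm] at hcl
  omega

theorem centerInnerAut_eq_of_card_commutator [Finite G] (hG : Nat.card G = p ^ 7)
    (hZ : ¬ Subgroup.center G ≤ commutator G) [IsCyclic (Subgroup.center G)]
    (hca : Nat.card (Subgroup.center G) = p ^ 2) (hcomm : Nat.card (commutator G) = p ^ 4)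
    (hcl : Group.nilpotencyClass G = 4) :
    centerInnerAut G = centralAutFixingCenter G := by
  have hpp := hp.out
  have hP : IsPGroup p G := IsPGroup.of_card hG
  have := hP.isNilpotent
  have hGc : ¬ IsMulCommutative G := by
    rw [← Group.IsNilpotent.nilpotencyClass_le_one_iff]; omega
  obtain ⟨k, hk, hkI, hkZ⟩ := card_commutator_inf_center hP hGc hZ
  have hk2 : k + 1 ≤ 2 := (Nat.pow_dvd_pow_iff_le_right hpp.one_lt).mp (hca ▸ hkZ)
  obtain rfl : k = 1 := by omega
  have hHP : IsPGroup p (G ⧸ Subgroup.center G) := hP.to_quotient _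
  have hHcard : Nat.card (G ⧸ Subgroup.center G) = p ^ 5 := card_quotient_center hG hca
  have := hHP.isNilpotent
  have hHcl : Group.nilpotencyClass (G ⧸ Subgroup.center G) = 3 := by
    rw [Group.nilpotencyClass_quotient_center, hcl]
  have hHc : ¬ IsMulCommutative (G ⧸ Subgroup.center G) := by
    rw [← Group.IsNilpotent.nilpotencyClass_le_one_iff]; omega
  have hHcomm : Nat.card (commutator (G ⧸ Subgroup.center G)) = p ^ 3 := by
    have h := card_commutator_eq_mul (Subgroup.center G)
    apply Nat.eq_of_mul_eq_mul_right (pow_pos hpp.pos 1)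
    rw [← pow_add, ← hkI, ← h, hcomm]
  have hA := card_abelianization_of_card_commutator (p := p) (n := 2) (k := 3) hHcard hHcomm
  rw [centerInnerAut_eq_iff_card, card_monoidHom_abelianization,
    card_center_of_nilpotencyClass_three hHcard hHcl hA, card_monoidHom_of_isCyclic, hA]
  rw [hca, ← hA]
  exact Group.exponent_dvd_nat_card

theorem centralAutFixingCenter_lt_of_card_commutator [Finite G] (hG : Nat.card G = p ^ 7)
    (hGc : ¬ IsMulCommutative G) (hZ : ¬ Subgroup.center G ≤ commutator G)
    [IsCyclic (Subgroup.center G)] (hca : Nat.card (Subgroup.center G) = p ^ 2)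
    (hcomm : Nat.card (commutator G) = p ^ 4) :
    centralAutFixingCenter G < centralAut G := by
  have hpp := hp.out
  have hP : IsPGroup p G := IsPGroup.of_card hG
  have := hP.isNilpotent
  have hA := card_abelianization_of_card_commutator (p := p) (n := 3) (k := 4) hG hcomm
  have hAe : Monoid.exponent (Abelianization G) ∣ 1 * Nat.card (Subgroup.center G) := by
    rw [one_mul, hca]
    exact exponent_dvd_of_not_isCyclic hA (hP.not_isCyclic_abelianization hGc)
  obtain ⟨z, hz, hzc⟩ := SetLike.not_le_iff_exists.mp hZ
  have hz1 : Abelianization.of z ^ 1 ≠ 1 := by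
    rw [pow_one]
    exact fun h => hzc ((QuotientGroup.eq_one_iff z).mp h)
  obtain ⟨f, hf⟩ := exists_monoidHom_apply_ne_one_of_isCyclic hAe hz1
  obtain ⟨k, hk, hkI, hkZ⟩ := card_commutator_inf_center hP hGc hZ
  have hk2 : k + 1 ≤ 2 := (Nat.pow_dvd_pow_iff_le_right hpp.one_lt).mp (hca ▸ hkZ)
  obtain rfl : k = 1 := by omega
  -- G' ∩ Z(G) has order p in the cyclic group Z(G), so it contains every central element of order
  -- p, and f is trivial there.
  have hsocle : ∀ w : Subgroup.center G, w * f (Abelianization.of (w : G)) = 1 →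
      w ^ p = 1 → w = 1 := by
    intro w hw hwp
    have hwI : w ∈ (commutator G ⊓ Subgroup.center G).subgroupOf (Subgroup.center G) := by
      apply IsCyclic.mem_of_pow_card_eq_one
      rw [Nat.card_congr (Subgroup.subgroupOfEquivOfLe inf_le_right).toEquiv, hkI, pow_one, hwp]
    have hwc : (Abelianization.of (w : G)) = 1 := (QuotientGroup.eq_one_iff _).mpr hwI.1
    rwa [hwc, map_one, mul_one] at hw
  obtain ⟨α, hα, hαf⟩ := exists_mulAut_of_monoidHom_center (f.comp Abelianization.of) (by
    intro z hz hzf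
    have h1 : (⟨z, hz⟩ : Subgroup.center G) * f (Abelianization.of z) = 1 := Subtype.ext hzf
    -- The p-th power of a kernel element is again in the kernel and is killed by p because |Z(G)| =
    -- p², so `hsocle` applies to it first and then to z itself.
    have h2 : (⟨z, hz⟩ : Subgroup.center G) ^ p = 1 := by
      apply hsocle
      · rw [Subgroup.coe_pow, map_pow, map_pow, ← mul_pow, h1, one_pow]
      · rw [← pow_mul, ← pow_two, ← hca, pow_card_eq_one']
    exact congrArg Subtype.val (hsocle _ h1 h2))
  refine lt_of_le_of_ne inf_le_left fun h => ?_
  have h1 := ((mem_centralAutFixingCenter_iff α).mp (h ▸ hα)).2 z hz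
  rw [hαf, mul_eq_left] at h1
  exact hf (Subtype.ext h1)

end Main

theorem theorem2p4 (p : ℕ) (hp : p.Prime) (G : Type*) [Group G] (hG : Nat.card G = p ^ 7)
    (hclass : 3 ≤ Group.nilpotencyClass G)
    (hZ : ¬ Subgroup.center G ≤ commutator G) :
    (centerInnerAut G = centralAutFixingCenter G ∧ centralAutFixingCenter G < centralAut G) ↔
      ((IsCyclic (Subgroup.center G) ∧ Nat.card (Subgroup.center G) = p ^ 2) ∧
        Nat.card (commutator G) = p ^ 4 ∧ Group.nilpotencyClass G = 4) := by
  have : Fact p.Prime := ⟨hp⟩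
  have : Finite G := Nat.finite_of_card_ne_zero (by rw [hG]; exact (pow_pos hp.pos 7).ne')
  constructor
  · rintro ⟨heq, -⟩
    obtain ⟨hcyc, hca⟩ := card_center_of_centerInnerAut_eq hG hclass hZ heq
    exact ⟨⟨hcyc, hca⟩, card_commutator_and_class_of_centerInnerAut_eq hG hclass hZ heq hca⟩
  · rintro ⟨⟨hcyc, hca⟩, hcomm, hcl⟩
    have := (IsPGroup.of_card hG).isNilpotent
    have hGc : ¬ IsMulCommutative G := by
      rw [← Group.IsNilpotent.nilpotencyClass_le_one_iff]; omega
    exact ⟨centerInnerAut_eq_of_card_commutator hG hZ hca hcomm hcl,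
      centralAutFixingCenter_lt_of_card_commutator hG hGc hZ hca hcomm⟩
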